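/- Let $d,m\ge 1$ be integers and let $\theta_1,\dots,\theta_m$ be distinct nonzero real numbers. For measurable complex-valued functions $f_1,\dots,f_m,g$ on $\mathbb{R}^d$ put $$\vec f\otimes g(x)=\int_{\mathbb{R}^d}f_1(x-\theta_1y)\cdots f_m(x-\theta_my)\,g(y)\,dy$$ whenever the integral converges absolutely. For $0<s<\infty$ let $\|g\|_{L^{s,\infty}}=\sup_{\alpha>0}\alpha\,|\{x\in\mathbb{R}^d:|g(x)|>\alpha\}|^{1/s}$, and let $L^{s,\infty}(\mathbb{R}^d)$ be the set of measurable $g$ for which this is finite. Let $1<r\le\infty$, let $r'\in[1,\infty)$ be its conjugate exponent ($1/r+1/r'=1$), let $1\le p_j\le\infty$ for $j=1,\dots,m$, and let $p,q\in(0,\infty]$ satisfy $$\frac1p=\frac1{p_1}+\cdots+\frac1{p_m},\qquad \frac1q+1=\frac1p+\frac1r .$$ Then $\frac{r'}{1+r'}\le p\le r'$ is equivalent to $1\le q\le\infty$, and there is a finite constant $C=C(d,m,\theta_j,p_j,r)$ such that the following hold. (a) Suppose $1<r<\infty$. The condition $1<p<r'$ is equivalent to $r<q<\infty$. If it holds,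 then for all $f_j\in L^{p_j}(\mathbb{R}^d)$ and $g\in L^{r,\infty}(\mathbb{R}^d)$ the integral $\vec f\otimes g(x)$ converges absolutely for almost every $x$, $\vec f\otimes g\in L^q(\mathbb{R}^d)$, and $$\|\vec f\otimes g\|_{L^q(\mathbb{R}^d)}\le C\prod_{i=1}^m\|f_i\|_{L^{p_i}(\mathbb{R}^d)}\,\|g\|_{L^{r,\infty}(\mathbb{R}^d)}.$$ (b) Suppose $1<r\le\infty$. The condition $\frac{r'}{1+r'}\le p\le1$ is equivalent to $1\le q\le r$. If it holds, then for all $f_j\in L^{p_j}(\mathbb{R}^d)$ and $g\in L^{r}(\mathbb{R}^d)$ the integral $\vec f\otimes g(x)$ converges absolutely for almost every $x$, $\vec f\otimes g\in L^q(\mathbb{R}^d)$, and $$\|\vec f\otimes g\|_{L^q(\mathbb{R}^d)}\le C\prod_{i=1}^m\|f_i\|_{L^{p_i}(\mathbb{R}^d)}\,\|g\|_{L^{r}(\mathbb{R}^d)}.$$ -/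

import Mathlib

open MeasureTheory
open scoped ENNReal NNReal

/-- The integrand `y ↦ f₁(x - θ₁ y) ⋯ fₘ(x - θₘ y) g(y)` of the multilinear convolution. -/
def multiConvIntegrand {d m : ℕ} (θ : Fin m → ℝ)
    (f : Fin m → EuclideanSpace ℝ (Fin d) → ℂ) (g : EuclideanSpace ℝ (Fin d) → ℂ)
    (x y : EuclideanSpace ℝ (Fin d)) : ℂ :=
  (∏ j, f j (x - θ j • y)) * g y

/-- The multilinear convolution
`(f ⊗ g)(x) = ∫ f₁(x - θ₁ y) ⋯ fₘ(x - θₘ y) g(y) dy`. -/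
noncomputable def multiConv {d m : ℕ} (θ : Fin m → ℝ)
    (f : Fin m → EuclideanSpace ℝ (Fin d) → ℂ) (g : EuclideanSpace ℝ (Fin d) → ℂ)
    (x : EuclideanSpace ℝ (Fin d)) : ℂ :=
  ∫ y, multiConvIntegrand θ f g x y

/-- The weak `L^s` quasinorm `sup_{α > 0} α |{x : |g x| > α}|^{1/s}`, for `0 < s < ∞`. -/
noncomputable def weakLpNorm {d : ℕ} (g : EuclideanSpace ℝ (Fin d) → ℂ) (s : ℝ) : ℝ≥0∞ :=
  ⨆ (α : ℝ) (_ : 0 < α), ENNReal.ofReal α * (volume {x | α < ‖g x‖}) ^ (1 / s)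

/-- Membership in weak `L^s`, for `0 < s < ∞`: measurable with finite weak quasinorm. -/
def MemWeakLp {d : ℕ} (g : EuclideanSpace ℝ (Fin d) → ℂ) (s : ℝ) : Prop :=
  AEStronglyMeasurable g volume ∧ weakLpNorm g s < ∞

/-! By duality, an $L^q$ bound amounts to a bound for the form $\iint H(x)^{1-1/q}\prod_j
F_j(x-\theta_j y)^{1/p_j}\,G(y)\,dx\,dy$, where $|f_j|\le\|f_j\|_{p_j}F_j^{1/p_j}$ and $H,F_j\ge0$
have integral at most 1. An infinite $p_j$ just becomes the exponent 0. As everything is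
nonnegative, absolute convergence comes with the bound (`multiConv_bounds_of_dual`).

For (b), $|g|$ is normalized in the same way. The exponents then lie in $[0,1]$ and sum to 2, and
the linear forms $x$, $y$, $x-\theta_jy$ are pairwise independent. If two exponents are 1 and the
others 0, a linear change of variables separates the integral. Every admissible exponent vector is a
convex combination of such vertices, by Birkhoff's theorem, and Hölder's inequality combines the
vertex bounds (`exists_lintegral_prod_rpow_le`).

For (a), Hölder's inequality reduces to a single $F$ with exponent $1/p$. The domain is split
according to which of $H(x)$ and $F(x-\theta y)$ is smaller. The layer-cake formula bounds the
smaller one's power, paired with $g$ in weak $L^r$, by a power of the larger one, whose total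
exponent becomes exactly 1 (`exists_weak_young`). -/

/-! ### Brascamp–Lieb inequality for rank-one forms in two variables. -/

/-- The linear automorphism `(x, y) ↦ (a x + b y, a' x + b' y)` of `E × E`. -/
noncomputable def pairLinearEquiv (E : Type*) [NormedAddCommGroup E] [NormedSpace ℝ E]
    {a b a' b' : ℝ} (h : a * b' - a' * b ≠ 0) : (E × E) ≃ₗ[ℝ] (E × E) where
  toFun z := (a • z.1 + b • z.2, a' • z.1 + b' • z.2)
  invFun z := ((a * b' - a' * b)⁻¹ • (b' • z.1 - b • z.2),
    (a * b' - a' * b)⁻¹ • (a • z.2 - a' • z.1))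
  map_add' z w := by ext <;> simp <;> module
  map_smul' c z := by ext <;> simp <;> module
  left_inv z := by
    ext
    · simp only
      rw [inv_smul_eq_iff₀ h]
      module
    · simp only
      rw [inv_smul_eq_iff₀ h]
      module
  right_inv z := by
    ext
    · simp only
      rw [smul_comm a, smul_comm b, ← smul_add, inv_smul_eq_iff₀ h]
      module
    · simp only
      rw [smul_comm a', smul_comm b', ← smul_add, inv_smul_eq_iff₀ h]
      module

section Haar

variable {E : Type*} [NormedAddCommGroup E] [NormedSpace ℝ E] [FiniteDimensional ℝ E]
  [MeasurableSpace E] [BorelSpace E] (μ : Measure E) [μ.IsAddHaarMeasure]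

theorem exists_lintegral_pair_le {a b a' b' : ℝ} (h : a * b' - a' * b ≠ 0) :
    ∃ K : ℝ≥0, ∀ F G : E → ℝ≥0∞, Measurable F → Measurable G →
      ∫⁻ z : E × E, F (a • z.1 + b • z.2) * G (a' • z.1 + b' • z.2) ∂(μ.prod μ) ≤
        K * ((∫⁻ x, F x ∂μ) * ∫⁻ x, G x ∂μ) := by
  let L : (E × E) ≃L[ℝ] (E × E) := (pairLinearEquiv E h).toContinuousLinearEquiv
  have : ((μ.prod μ).map L).IsAddHaarMeasure := L.isAddHaarMeasure_map _
  obtain ⟨K, h1⟩ : ∃ K : ℝ≥0, (μ.prod μ).map L = K • μ.prod μ :=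
    ⟨_, Measure.isAddLeftInvariant_eq_smul ((μ.prod μ).map L) (μ.prod μ)⟩
  refine ⟨K, fun F G hF hG ↦ le_of_eq ?_⟩
  have hm : Measurable fun w : E × E ↦ F w.1 * G w.2 := by fun_prop
  have h2 : ∫⁻ z : E × E, F (a • z.1 + b • z.2) * G (a' • z.1 + b' • z.2) ∂(μ.prod μ) =
      ∫⁻ w, F w.1 * G w.2 ∂((μ.prod μ).map L) := by
    rw [lintegral_map hm L.continuous.measurable]
    rfl
  rw [h2, h1, lintegral_smul_measure, lintegral_prod_mul hF.aemeasurable hG.aemeasurable]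
  rfl

theorem ENNReal.rpow_sum_of_nonneg {κ : Type*} (s : Finset κ) (x : ℝ≥0∞) {w : κ → ℝ}
    (hw : ∀ i ∈ s, 0 ≤ w i) : x ^ (∑ i ∈ s, w i) = ∏ i ∈ s, x ^ w i := by
  classical
  induction s using Finset.induction_on with
  | empty => simp
  | insert i s hi ih =>
    rw [Finset.sum_insert hi, Finset.prod_insert hi,
      ENNReal.rpow_add_of_nonneg _ _ (hw i (Finset.mem_insert_self i s))
        (Finset.sum_nonneg fun j hj ↦ hw j (Finset.mem_insert_of_mem hj)),
      ih fun j hj ↦ hw j (Finset.mem_insert_of_mem hj)]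

/-- Points of the hypersimplex `{c ∈ [0, 1]^ι | ∑ c = 2}` are convex combinations of sums of two
distinct basis vectors. -/
theorem exists_perm_weights {ι : Type*} [Fintype ι] [DecidableEq ι]
    (hcard : 2 < Fintype.card ι) {i₀ i₁ : ι} (hne : i₀ ≠ i₁) {c : ι → ℝ} (hc0 : ∀ i, 0 ≤ c i)
    (hc1 : ∀ i, c i ≤ 1) (hc : ∑ i, c i = 2) :
    ∃ w : Equiv.Perm ι → ℝ, (∀ σ, 0 ≤ w σ) ∧ ∑ σ, w σ = 1 ∧
      ∀ j, c j = ∑ σ, ((if σ i₀ = j then w σ else 0) + (if σ i₁ = j then w σ else 0)) := by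
  have hN : (0 : ℝ) < Fintype.card ι - 2 := by
    have : (2 : ℝ) < Fintype.card ι := by exact_mod_cast hcard
    linarith
  -- Rows `i₀` and `i₁` are both `c / 2`, and the other rows share `1 - c` equally. In a Birkhoff
  -- decomposition of `M`, adding these two rows recovers `c`.
  let M : Matrix ι ι ℝ := fun i j ↦
    if i ∈ ({i₀, i₁} : Finset ι) then c j / 2 else (1 - c j) / (Fintype.card ι - 2)
  have hM : M ∈ doublyStochastic ℝ ι := by
    rw [mem_doublyStochastic_iff_sum]
    refine ⟨fun i j ↦ ?_, fun i ↦ ?_, fun j ↦ ?_⟩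
    · simp only [M]
      split_ifs
      · have := hc0 j
        positivity
      · exact div_nonneg (by linarith [hc1 j]) hN.le
    · simp only [M]
      split_ifs
      · rw [← Finset.sum_div, hc]; norm_num
      · rw [← Finset.sum_div, Finset.sum_sub_distrib, hc]
        simp [hN.ne']
    · simp only [M]
      rw [Finset.sum_ite, Finset.sum_const, Finset.sum_const, Finset.filter_mem_eq_inter,
        Finset.univ_inter, Finset.card_pair hne, Finset.filter_not, Finset.filter_mem_eq_inter,
        Finset.univ_inter, Finset.card_sdiff_of_subset (Finset.subset_univ _),
        Finset.card_pair hne, Finset.card_univ, nsmul_eq_mul, nsmul_eq_mul,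
        Nat.cast_sub hcard.le]
      push_cast
      field_simp
      ring
  obtain ⟨w, hw0, hw1, hwM⟩ := exists_eq_sum_perm_of_mem_doublyStochastic hM
  refine ⟨w, hw0, hw1, fun j ↦ ?_⟩
  have key : ∀ i, M i j = ∑ σ : Equiv.Perm ι, if σ i = j then w σ else 0 := fun i ↦ by
    rw [← hwM, Matrix.sum_apply]
    refine Finset.sum_congr rfl fun σ _ ↦ ?_
    simp [Equiv.Perm.permMatrix, PEquiv.toMatrix_apply, Equiv.toPEquiv_apply, eq_comm]
  rw [Finset.sum_add_distrib, ← key, ← key]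
  simp [M]

/-- The rank-one Brascamp–Lieb inequality for linear forms `a i • x + b i • y` on `E × E`, no two of
which are proportional. -/
theorem exists_lintegral_prod_rpow_le {ι : Type*} [Fintype ι] (hcard : 2 < Fintype.card ι)
    {a b : ι → ℝ} (hab : ∀ i j, i ≠ j → a i * b j - a j * b i ≠ 0) {c : ι → ℝ}
    (hc0 : ∀ i, 0 ≤ c i) (hc1 : ∀ i, c i ≤ 1) (hc : ∑ i, c i = 2) :
    ∃ K : ℝ≥0, ∀ F : ι → E → ℝ≥0∞, (∀ i, Measurable (F i)) → (∀ i, ∫⁻ x, F i x ∂μ ≤ 1) →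
      ∫⁻ z : E × E, ∏ i, F i (a i • z.1 + b i • z.2) ^ c i ∂(μ.prod μ) ≤ K := by
  classical
  obtain ⟨i₀, i₁, hne⟩ := Fintype.exists_pair_of_one_lt_card (α := ι) (by omega)
  obtain ⟨w, hw0, hw1, hwc⟩ := exists_perm_weights hcard hne hc0 hc1 hc
  have hσ : ∀ σ : Equiv.Perm ι, σ i₀ ≠ σ i₁ := fun σ ↦ σ.injective.ne hne
  choose K hK using fun σ : Equiv.Perm ι ↦ exists_lintegral_pair_le μ (hab _ _ (hσ σ))
  refine ⟨∏ σ, K σ ^ w σ, fun F hFm hF ↦ ?_⟩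
  -- Substituting the decomposition of `c` regroups the product by permutations. Hölder with weights
  -- `w σ` then leaves integrals with two factors only, which separate.
  have hfac : ∀ z : E × E, ∏ i, F i (a i • z.1 + b i • z.2) ^ c i =
      ∏ σ : Equiv.Perm ι, (F (σ i₀) (a (σ i₀) • z.1 + b (σ i₀) • z.2) *
        F (σ i₁) (a (σ i₁) • z.1 + b (σ i₁) • z.2)) ^ w σ := fun z ↦ by
    have h0 : ∀ (i j : ι) (σ : Equiv.Perm ι), 0 ≤ if σ i = j then w σ else 0 :=
      fun i j σ ↦ by split_ifs <;> simp [hw0]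
    have h1 : ∀ j, F j (a j • z.1 + b j • z.2) ^ c j = ∏ σ : Equiv.Perm ι,
        (if σ i₀ = j then F j (a j • z.1 + b j • z.2) ^ w σ else 1) *
        (if σ i₁ = j then F j (a j • z.1 + b j • z.2) ^ w σ else 1) := fun j ↦ by
      rw [hwc j, ENNReal.rpow_sum_of_nonneg _ _ fun σ _ ↦ add_nonneg (h0 _ _ _) (h0 _ _ _)]
      refine Finset.prod_congr rfl fun σ _ ↦ ?_
      rw [ENNReal.rpow_add_of_nonneg _ _ (h0 _ _ _) (h0 _ _ _)]
      congr 1 <;> split_ifs <;> simp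
    simp_rw [h1]
    rw [Finset.prod_comm]
    refine Finset.prod_congr rfl fun σ _ ↦ ?_
    rw [Finset.prod_mul_distrib, Finset.prod_ite_eq, Finset.prod_ite_eq,
      ENNReal.mul_rpow_of_nonneg _ _ (hw0 σ)]
    simp
  simp_rw [hfac]
  refine (ENNReal.lintegral_prod_norm_pow_le Finset.univ (fun σ _ ↦ ?_) hw1
    fun σ _ ↦ hw0 σ).trans ?_
  · exact Measurable.aemeasurable (by fun_prop)
  · rw [ENNReal.ofNNReal_finsetProd]
    refine Finset.prod_le_prod' fun σ _ ↦ ?_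
    rw [ENNReal.coe_rpow_of_nonneg _ (hw0 σ)]
    refine ENNReal.rpow_le_rpow ((hK σ _ _ (hFm _) (hFm _)).trans ?_) (hw0 σ)
    exact mul_le_of_le_one_right' (mul_le_one' (hF _) (hF _))

end Haar

/-! ### Normalization of $L^p$ functions and duality. -/

/-- Replacing `f` by a power of a function in the unit ball of $L^1$ turns Hölder exponents into
plain exponents and treats `P = ∞` uniformly. -/
theorem MeasureTheory.MemLp.exists_enorm_le_mul_rpow {α V : Type*} [MeasurableSpace α]
    [NormedAddCommGroup V] {μ : Measure α} {f : α → V} {P : ℝ≥0∞} (hf : MemLp f P μ) (hP : P ≠ 0) :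
    ∃ F : α → ℝ≥0∞, Measurable F ∧ ∫⁻ x, F x ∂μ ≤ 1 ∧
      ∀ᵐ x ∂μ, ‖f x‖ₑ ≤ eLpNorm f P μ * F x ^ P⁻¹.toReal := by
  by_cases hN : eLpNorm f P μ = 0
  · refine ⟨0, measurable_zero, by simp, ?_⟩
    filter_upwards [(eLpNorm_eq_zero_iff hf.1 hP).1 hN] with x hx
    simp [hx]
  rcases eq_or_ne P ∞ with rfl | hPtop
  -- The exponent is 0 and `0 ^ 0 = 1`, so `F = 0` serves.
  · refine ⟨0, measurable_zero, by simp, ?_⟩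
    filter_upwards [ae_le_eLpNormEssSup (f := f) (μ := μ)] with x hx
    simpa using hx
  have hP0 : 0 < P.toReal := ENNReal.toReal_pos hP hPtop
  have hNtop : eLpNorm f P μ ≠ ∞ := hf.2.ne
  have hm := hf.1
  set N := eLpNorm f P μ with hNdef
  refine ⟨fun x ↦ (N⁻¹ * ‖hm.mk f x‖ₑ) ^ P.toReal, ?_, ?_, ?_⟩
  · exact ((hm.stronglyMeasurable_mk.enorm).const_mul _).pow_const _
  · have h1 : ∫⁻ x, ‖hm.mk f x‖ₑ ^ P.toReal ∂μ = N ^ P.toReal := by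
      rw [hNdef, eLpNorm_congr_ae hm.ae_eq_mk,
        eLpNorm_eq_lintegral_rpow_enorm_toReal hP hPtop, ← ENNReal.rpow_mul,
        one_div_mul_cancel hP0.ne', ENNReal.rpow_one]
    simp_rw [ENNReal.mul_rpow_of_nonneg _ _ hP0.le]
    rw [lintegral_const_mul _ ((hm.stronglyMeasurable_mk.enorm).pow_const _), h1,
      ← ENNReal.mul_rpow_of_nonneg _ _ hP0.le, ENNReal.inv_mul_cancel hN hNtop, ENNReal.one_rpow]
  · filter_upwards [hm.ae_eq_mk] with x hx
    rw [← hx, ← ENNReal.rpow_mul, ENNReal.toReal_inv, mul_inv_cancel₀ hP0.ne', ENNReal.rpow_one,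
      ← mul_assoc, ENNReal.mul_inv_cancel hN hNtop, one_mul]

/-- The extremal test function is `H = V ^ Q / J` with `J = ∫ V ^ Q`; it gives `J ^ (1 / Q) ≤ C`.
Dividing by `J` requires it finite, hence the minorant `V` of `u`. -/
theorem lintegral_rpow_le_of_forall_dual {α : Type*} [MeasurableSpace α] {μ : Measure α}
    {u V : α → ℝ≥0∞} (hV : Measurable V) (hVu : V ≤ u) {Q : ℝ} (hQ : 1 ≤ Q)
    (hVfin : ∫⁻ x, V x ^ Q ∂μ ≠ ∞) {C : ℝ≥0∞}
    (h : ∀ H : α → ℝ≥0∞, Measurable H → ∫⁻ x, H x ∂μ ≤ 1 →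
      ∫⁻ x, H x ^ (1 - Q⁻¹) * u x ∂μ ≤ C) : ∫⁻ x, V x ^ Q ∂μ ≤ C ^ Q := by
  have hQ0 : 0 < Q := by linarith
  have hκ : 0 ≤ 1 - Q⁻¹ := by
    have := inv_le_one_of_one_le₀ hQ
    linarith
  set J := ∫⁻ x, V x ^ Q ∂μ with hJ
  rcases eq_or_ne J 0 with h0 | h0
  · simp [h0]
  have h1 := h (fun x ↦ J⁻¹ * V x ^ Q) ((hV.pow_const _).const_mul _) (by
    rw [lintegral_const_mul _ (hV.pow_const _), ← hJ, ENNReal.inv_mul_cancel h0 hVfin])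
  have h2 : ∀ x, (J⁻¹) ^ (1 - Q⁻¹) * V x ^ Q ≤ (J⁻¹ * V x ^ Q) ^ (1 - Q⁻¹) * u x := fun x ↦ by
    rw [ENNReal.mul_rpow_of_nonneg _ _ hκ, mul_assoc, ← ENNReal.rpow_mul]
    gcongr
    have : Q * (1 - Q⁻¹) = Q - 1 := by field_simp
    rw [this]
    calc V x ^ Q = V x ^ ((Q - 1) + 1) := by ring_nf
      _ = V x ^ (Q - 1) * V x := by
        rw [ENNReal.rpow_add_of_nonneg _ _ (by linarith) zero_le_one, ENNReal.rpow_one]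
      _ ≤ _ := by gcongr; exact hVu x
  have h3 : (J⁻¹) ^ (1 - Q⁻¹) * J ≤ C := by
    rw [hJ, ← lintegral_const_mul _ (hV.pow_const _)]
    exact (lintegral_mono h2).trans h1
  have h4 : (J⁻¹) ^ (1 - Q⁻¹) * J = J ^ Q⁻¹ := by
    rw [← ENNReal.rpow_neg_one, ← ENNReal.rpow_mul]
    nth_rewrite 2 [← ENNReal.rpow_one J]
    rw [← ENNReal.rpow_add _ _ h0 hVfin]
    ring_nf
  rw [h4] at h3
  calc J = (J ^ Q⁻¹) ^ Q := by rw [← ENNReal.rpow_mul, inv_mul_cancel₀ hQ0.ne', ENNReal.rpow_one]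
    _ ≤ C ^ Q := by gcongr

/-- The converse of Hölder's inequality, with the dual function written as `H ^ (1 - 1 / q)` for
`H` in the unit ball of `L¹`. -/
theorem eLpNorm_le_of_forall_dual {α : Type*} [MeasurableSpace α] {μ : Measure α} [SigmaFinite μ]
    {u : α → ℝ≥0∞} (hu : Measurable u) {q : ℝ≥0∞} (hq : 1 ≤ q) {C : ℝ≥0∞}
    (h : ∀ H : α → ℝ≥0∞, Measurable H → ∫⁻ x, H x ∂μ ≤ 1 →
      ∫⁻ x, H x ^ (1 - q⁻¹.toReal) * u x ∂μ ≤ C) : eLpNorm u q μ ≤ C := by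
  rcases eq_or_ne q ∞ with rfl | hqtop
  · rw [eLpNorm_exponent_top]
    refine eLpNormEssSup_le_of_ae_enorm_bound ?_
    refine ae_le_of_forall_setLIntegral_le_of_sigmaFinite hu fun s hs hμs ↦ ?_
    simp only [enorm_eq_self, setLIntegral_const]
    rcases eq_or_ne (μ s) 0 with h0 | h0
    · rw [setLIntegral_measure_zero _ _ h0]; exact zero_le
    -- For `q = ∞` the exponent of `H` is 1, so a normalized indicator tests the average of `u` over
    -- `s`.
    have h1 := h (s.indicator fun _ ↦ (μ s)⁻¹) (measurable_const.indicator hs) (by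
      rw [lintegral_indicator hs, setLIntegral_const, ENNReal.inv_mul_cancel h0 hμs.ne])
    have h2 : ∀ x, s.indicator (fun _ ↦ (μ s)⁻¹) x ^ (1 - (∞⁻¹ : ℝ≥0∞).toReal) * u x =
        s.indicator (fun x ↦ (μ s)⁻¹ * u x) x := fun x ↦ by
      by_cases hx : x ∈ s <;> simp [hx]
    simp_rw [h2] at h1
    rw [lintegral_indicator hs, lintegral_const_mul _ hu] at h1
    calc ∫⁻ x in s, u x ∂μ = μ s * ((μ s)⁻¹ * ∫⁻ x in s, u x ∂μ) := by
          rw [← mul_assoc, ENNReal.mul_inv_cancel h0 hμs.ne, one_mul]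
      _ ≤ μ s * C := by gcongr
      _ = C * μ s := mul_comm _ _
  have hQ : 1 ≤ q.toReal := by
    rw [← ENNReal.toReal_one]
    exact ENNReal.toReal_mono hqtop hq
  have hQ0 : 0 < q.toReal := by linarith
  rw [eLpNorm_eq_lintegral_rpow_enorm_toReal (by positivity) hqtop, one_div,
    ENNReal.rpow_inv_le_iff hQ0]
  simp only [enorm_eq_self]
  -- Truncation in height and support makes the integrals finite; Fatou's lemma removes it.
  let V : ℕ → α → ℝ≥0∞ := fun n ↦ (spanningSets μ n).indicator fun x ↦ min (u x) n
  have hVm : ∀ n, Measurable (V n) := fun n ↦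
    (hu.min measurable_const).indicator (measurableSet_spanningSets μ n)
  have hV : ∀ n, ∫⁻ x, V n x ^ q.toReal ∂μ ≤ C ^ q.toReal := fun n ↦ by
    refine lintegral_rpow_le_of_forall_dual (hVm n) (fun x ↦ ?_) hQ ?_ (by simpa using h)
    · exact (Set.indicator_le_self' (fun _ _ ↦ zero_le) x).trans (min_le_left _ _)
    · have : ∀ x, V n x ^ q.toReal ≤
          (spanningSets μ n).indicator (fun _ ↦ (n : ℝ≥0∞) ^ q.toReal) x := fun x ↦ by
        by_cases hx : x ∈ spanningSets μ n
        · simp only [V, Set.indicator_of_mem hx]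
          gcongr
          exact min_le_right _ _
        · simp [V, hx, hQ0]
      refine ((lintegral_mono this).trans_lt ?_).ne
      rw [lintegral_indicator (measurableSet_spanningSets μ n), setLIntegral_const]
      exact ENNReal.mul_lt_top (by finiteness) (measure_spanningSets_lt_top μ n)
  have hlim : ∀ x, Filter.Tendsto (fun n ↦ V n x ^ q.toReal) Filter.atTop
      (nhds (u x ^ q.toReal)) := fun x ↦ by
    refine (ENNReal.continuous_rpow_const.tendsto _).comp ?_
    have h1 : Filter.Tendsto (fun n : ℕ ↦ min (u x) (n : ℝ≥0∞)) Filter.atTop (nhds (u x)) := by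
      simpa using tendsto_const_nhds.min ENNReal.tendsto_nat_nhds_top
    refine h1.congr' ?_
    filter_upwards [Filter.eventually_ge_atTop (spanningSetsIndex μ x)] with n hn
    have : x ∈ spanningSets μ n := mem_spanningSets_of_index_le μ x hn
    simp [V, this]
  calc ∫⁻ x, u x ^ q.toReal ∂μ
      = ∫⁻ x, Filter.liminf (fun n ↦ V n x ^ q.toReal) Filter.atTop ∂μ :=
        lintegral_congr fun x ↦ (hlim x).liminf_eq.symm
    _ ≤ Filter.liminf (fun n ↦ ∫⁻ x, V n x ^ q.toReal ∂μ) Filter.atTop :=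
        lintegral_liminf_le fun n ↦ (hVm n).pow_const _
    _ ≤ C ^ q.toReal := by
        refine Filter.liminf_le_of_le (by isBoundedDefault) fun b hb ↦ ?_
        obtain ⟨n, hn⟩ := hb.exists
        exact hn.trans (hV n)

/-! ### Pairing weak $L^r$ with a truncated power. -/

theorem Real.div_rpow_eq_mul_rpow_neg {W γ s : ℝ} (hW : 0 ≤ W) (hγ : 0 < γ) :
    (W / γ) ^ s = W ^ s * γ ^ (-s) := by
  rw [Real.div_rpow hW hγ.le, Real.rpow_neg hγ.le, div_eq_mul_inv]

theorem lintegral_Ioc_div_rpow {W T s : ℝ} (hW : 0 ≤ W) (hT : 0 < T) (hs : s < 1) :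
    ∫⁻ γ in Set.Ioc 0 T, ENNReal.ofReal ((W / γ) ^ s) =
      ENNReal.ofReal (W ^ s * T ^ (1 - s) / (1 - s)) := by
  have h1 : IntegrableOn (fun γ : ℝ ↦ W ^ s * γ ^ (-s)) (Set.Ioc 0 T) := by
    rw [← intervalIntegrable_iff_integrableOn_Ioc_of_le hT.le]
    exact (intervalIntegral.intervalIntegrable_rpow' (by linarith)).const_mul _
  rw [setLIntegral_congr_fun measurableSet_Ioc
    (fun γ hγ ↦ by rw [Real.div_rpow_eq_mul_rpow_neg hW hγ.1]),
    ← ofReal_integral_eq_lintegral_ofReal h1, ← intervalIntegral.integral_of_le hT.le,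
    intervalIntegral.integral_const_mul, integral_rpow (Or.inl (by linarith)),
    Real.zero_rpow (by linarith)]
  · ring_nf
  · filter_upwards [ae_restrict_mem measurableSet_Ioc] with γ hγ
    have := hγ.1
    positivity

theorem lintegral_Ioi_div_rpow {W T s : ℝ} (hW : 0 ≤ W) (hT : 0 < T) (hs : 1 < s) :
    ∫⁻ γ in Set.Ioi T, ENNReal.ofReal ((W / γ) ^ s) =
      ENNReal.ofReal (W ^ s * T ^ (1 - s) / (s - 1)) := by
  have h1 : IntegrableOn (fun γ : ℝ ↦ W ^ s * γ ^ (-s)) (Set.Ioi T) :=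
    (integrableOn_Ioi_rpow_of_lt (by linarith) hT).const_mul _
  rw [setLIntegral_congr_fun measurableSet_Ioi
    (fun γ hγ ↦ by rw [Real.div_rpow_eq_mul_rpow_neg hW (hT.trans hγ)]),
    ← ofReal_integral_eq_lintegral_ofReal h1, integral_const_mul,
    integral_Ioi_rpow_of_lt (by linarith) hT]
  · congr 1
    rw [neg_add_eq_sub, ← neg_sub s 1, div_neg, neg_div, neg_neg, mul_div_assoc]
  · filter_upwards [ae_restrict_mem measurableSet_Ioi] with γ hγ
    have := hT.trans hγ
    positivity

section WeakPairing

variable {α : Type*} [MeasurableSpace α] {μ : Measure α}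

/-- Hölder against the constant 1 on `s`; `1 ≤ K` allows `K ^ b` to be replaced by `K`. -/
theorem setLIntegral_rpow_le {B : α → ℝ≥0∞} (hB : Measurable B) {K : ℝ≥0} (hK1 : 1 ≤ K)
    (hBK : ∫⁻ x, B x ∂μ ≤ K) {b : ℝ} (hb0 : 0 ≤ b) (hb1 : b ≤ 1) (s : Set α) :
    ∫⁻ x in s, B x ^ b ∂μ ≤ K * μ s ^ (1 - b) := by
  have h1 := ENNReal.lintegral_mul_norm_pow_le (μ := μ.restrict s) hB.aemeasurable
    (g := fun _ ↦ 1) aemeasurable_const hb0 (sub_nonneg.2 hb1) (by ring)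
  simp only [ENNReal.one_rpow, mul_one, lintegral_const, Measure.restrict_apply MeasurableSet.univ,
    Set.univ_inter, one_mul] at h1
  refine h1.trans ?_
  gcongr
  calc (∫⁻ x in s, B x ∂μ) ^ b ≤ (K : ℝ≥0∞) ^ b := by
        gcongr
        exact (setLIntegral_le_lintegral _ _).trans hBK
    _ ≤ (K : ℝ≥0∞) ^ (1 : ℝ) := ENNReal.rpow_le_rpow_of_exponent_le (by exact_mod_cast hK1) hb1
    _ = K := ENNReal.rpow_one _

/-- The constant in the pairing of weak `L^r` with truncated powers. -/
noncomputable def weakPairingConst (r b : ℝ) : ℝ := 1 / (1 - r * (1 - b)) + 1 / (r - 1)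

/-- A weak `L^r` function paired with the truncation of `B ^ b` at the level `B ≤ N`. -/
theorem lintegral_truncated_mul_le {B : α → ℝ≥0∞} (hB : Measurable B) {K : ℝ≥0} (hK1 : 1 ≤ K)
    (hBK : ∫⁻ x, B x ∂μ ≤ K) {φ : α → ℝ} (hφ : Measurable φ) (hφ0 : ∀ x, 0 ≤ φ x)
    {W : ℝ≥0} {r : ℝ} (hr : 1 < r)
    (hW : ∀ γ : ℝ, 0 < γ → μ {x | γ < φ x} ≤ ENNReal.ofReal ((W / γ) ^ r))
    {b : ℝ} (hb : 1 - r⁻¹ < b) (hb1 : b < 1) (N : ℝ≥0∞) :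
    ∫⁻ x, (if B x ≤ N then B x ^ b else 0) * ENNReal.ofReal (φ x) ∂μ ≤
      K * ENNReal.ofReal (weakPairingConst r b) * W * N ^ (b - (1 - r⁻¹)) := by
  have hr0 : 0 < r := by linarith
  have hri : r⁻¹ < 1 := inv_lt_one_of_one_lt₀ hr
  have hb0 : 0 < b := by linarith
  have hs : r * (1 - b) < 1 := by
    have : r * (1 - b) < r * r⁻¹ := by gcongr; linarith
    rwa [mul_inv_cancel₀ hr0.ne'] at this
  have hA1 : 0 < 1 / (1 - r * (1 - b)) := one_div_pos.2 (by linarith)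
  have hA2 : 0 < 1 / (r - 1) := one_div_pos.2 (by linarith)
  have hk : Measurable fun x ↦ if B x ≤ N then B x ^ b else 0 :=
    Measurable.ite (measurableSet_le hB measurable_const) (hB.pow_const _) measurable_const
  set k := fun x ↦ if B x ≤ N then B x ^ b else 0 with hkdef
  set ν := μ.withDensity k with hν
  -- Layer-cake formula for `φ` with respect to the measure of density `k`.
  have hlayer : ∫⁻ x, k x * ENNReal.ofReal (φ x) ∂μ = ∫⁻ γ in Set.Ioi 0, ν {x | γ < φ x} := by
    rw [← lintegral_eq_lintegral_meas_lt ν (Filter.Eventually.of_forall hφ0) hφ.aemeasurable,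
      hν, lintegral_withDensity_eq_lintegral_mul _ hk hφ.ennreal_ofReal]
    rfl
  have hE : ∀ γ, MeasurableSet {x | γ < φ x} := fun γ ↦ measurableSet_lt measurable_const hφ
  have hk1 : ∀ x, k x ≤ N ^ b := fun x ↦ by
    simp only [hkdef]
    split_ifs with h
    · gcongr
    · exact zero_le
  have hk2 : ∀ x, k x ≤ B x ^ b := fun x ↦ by
    simp only [hkdef]
    split_ifs with h
    · exact le_rfl
    · exact zero_le
  have hlarge : ∀ γ, 0 < γ → ν {x | γ < φ x} ≤ N ^ b * ENNReal.ofReal ((W / γ) ^ r) := fun γ hγ ↦ by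
    rw [hν, withDensity_apply _ (hE γ)]
    calc ∫⁻ x in {x | γ < φ x}, k x ∂μ ≤ ∫⁻ x in {x | γ < φ x}, N ^ b ∂μ := lintegral_mono hk1
      _ = N ^ b * μ {x | γ < φ x} := setLIntegral_const _ _
      _ ≤ _ := by gcongr; exact hW γ hγ
  have hsmall : ∀ γ, 0 < γ →
      ν {x | γ < φ x} ≤ K * ENNReal.ofReal ((W / γ) ^ (r * (1 - b))) := fun γ hγ ↦ by
    rw [hν, withDensity_apply _ (hE γ)]
    have h0 : 0 ≤ W / γ := by positivity
    calc ∫⁻ x in {x | γ < φ x}, k x ∂μ ≤ ∫⁻ x in {x | γ < φ x}, B x ^ b ∂μ := lintegral_mono hk2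
      _ ≤ K * μ {x | γ < φ x} ^ (1 - b) := setLIntegral_rpow_le hB hK1 hBK hb0.le hb1.le _
      _ ≤ K * ENNReal.ofReal ((W / γ) ^ r) ^ (1 - b) := by gcongr; exact hW γ hγ
      _ = _ := by
        rw [ENNReal.ofReal_rpow_of_nonneg (by positivity) (by linarith), Real.rpow_mul h0]
  change ∫⁻ x, k x * ENNReal.ofReal (φ x) ∂μ ≤ _
  rw [hlayer]
  have hvanish : (∀ γ : ℝ, 0 < γ → ν {x | γ < φ x} = 0) →
      ∫⁻ γ in Set.Ioi 0, ν {x | γ < φ x} = 0 := fun h ↦ by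
    rw [setLIntegral_congr_fun measurableSet_Ioi (fun γ hγ ↦ h γ hγ)]
    simp
  rcases eq_or_ne W 0 with rfl | hW0
  · rw [hvanish fun γ hγ ↦ le_zero_iff.1 ((hlarge γ hγ).trans_eq (by simp [hr0.ne']))]
    exact zero_le
  rcases eq_or_ne N 0 with rfl | hN0
  · rw [hvanish fun γ hγ ↦ le_zero_iff.1 ((hlarge γ hγ).trans_eq (by simp [hb0]))]
    exact zero_le
  have hWpos : (0 : ℝ) < W := by positivity
  rcases eq_or_ne N ∞ with rfl | hNtop
  · rw [ENNReal.top_rpow_of_pos (by linarith), ENNReal.mul_top]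
    · exact le_top
    · have : 0 < weakPairingConst r b := add_pos hA1 hA2
      have : K ≠ 0 := by positivity
      simp_all
  lift N to ℝ≥0 using hNtop
  have hn : (0 : ℝ) < N := by
    have : N ≠ 0 := by exact_mod_cast hN0
    positivity
  -- At this height `(W / T) ^ r = 1 / N`, so the bounds `hlarge` and `hsmall` agree up to the
  -- factor `K`. The former is integrable at infinity as `1 < r`, the latter at 0 as `r * (1 - b) <
  -- 1`.
  set T : ℝ := W * N ^ r⁻¹ with hT
  have hTpos : 0 < T := by positivity
  have hpow : ∀ s : ℝ, (W : ℝ) ^ s * T ^ (1 - s) = W * N ^ ((1 - s) * r⁻¹) := fun s ↦ by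
    rw [hT, Real.mul_rpow hWpos.le (by positivity), ← mul_assoc, ← Real.rpow_add hWpos,
      ← Real.rpow_mul hn.le, add_sub_cancel, Real.rpow_one, mul_comm r⁻¹]
  have e1 : (1 - r * (1 - b)) * r⁻¹ = b - (1 - r⁻¹) := by
    field_simp
    ring
  have e2 : b + (1 - r) * r⁻¹ = b - (1 - r⁻¹) := by
    field_simp
    ring
  have hD : 0 ≤ (W : ℝ) * N ^ (b - (1 - r⁻¹)) := by positivity
  have hbig : ∫⁻ γ in Set.Ioi T, ν {x | γ < φ x} ≤
      K * ENNReal.ofReal ((W * N ^ (b - (1 - r⁻¹))) * (1 / (r - 1))) := by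
    calc ∫⁻ γ in Set.Ioi T, ν {x | γ < φ x}
        ≤ ∫⁻ γ in Set.Ioi T, (N : ℝ≥0∞) ^ b * ENNReal.ofReal ((W / γ) ^ r) :=
          setLIntegral_mono' measurableSet_Ioi fun γ hγ ↦ hlarge γ (hTpos.trans hγ)
      _ = (N : ℝ≥0∞) ^ b * ENNReal.ofReal (W ^ r * T ^ (1 - r) / (r - 1)) := by
          rw [lintegral_const_mul _ (by fun_prop), lintegral_Ioi_div_rpow hWpos.le hTpos hr]
      _ = ENNReal.ofReal ((W * N ^ (b - (1 - r⁻¹))) * (1 / (r - 1))) := by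
          rw [hpow, ← ENNReal.ofReal_coe_nnreal, ENNReal.ofReal_rpow_of_pos hn,
            ← ENNReal.ofReal_mul (by positivity), ← e2, Real.rpow_add hn]
          ring_nf
      _ ≤ _ := le_mul_of_one_le_left' (by exact_mod_cast hK1)
  have hlow : ∫⁻ γ in Set.Ioc 0 T, ν {x | γ < φ x} ≤
      K * ENNReal.ofReal ((W * N ^ (b - (1 - r⁻¹))) * (1 / (1 - r * (1 - b)))) := by
    calc ∫⁻ γ in Set.Ioc 0 T, ν {x | γ < φ x}
        ≤ ∫⁻ γ in Set.Ioc 0 T, K * ENNReal.ofReal ((W / γ) ^ (r * (1 - b))) :=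
          setLIntegral_mono' measurableSet_Ioc fun γ hγ ↦ hsmall γ hγ.1
      _ = _ := by
          rw [lintegral_const_mul _ (by fun_prop), lintegral_Ioc_div_rpow hWpos.le hTpos hs, hpow,
            e1, div_eq_mul_one_div]
  calc ∫⁻ γ in Set.Ioi 0, ν {x | γ < φ x}
      = (∫⁻ γ in Set.Ioc 0 T, ν {x | γ < φ x}) + ∫⁻ γ in Set.Ioi T, ν {x | γ < φ x} := by
        rw [← Set.Ioc_union_Ioi_eq_Ioi hTpos.le,
          lintegral_union measurableSet_Ioi Set.Ioc_disjoint_Ioi_same]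
    _ ≤ _ := add_le_add hlow hbig
    _ = K * ENNReal.ofReal (weakPairingConst r b) * W * (N : ℝ≥0∞) ^ (b - (1 - r⁻¹)) := by
        rw [← mul_add, ← ENNReal.ofReal_add (by positivity) (by positivity), ← mul_add,
          ENNReal.ofReal_mul hD, ENNReal.ofReal_mul hWpos.le, ← ENNReal.ofReal_rpow_of_pos hn,
          ENNReal.ofReal_coe_nnreal, ENNReal.ofReal_coe_nnreal, weakPairingConst]
        ring

end WeakPairing

/-! ### Weak Young inequality for one factor. -/

section Young

variable {E : Type*} [NormedAddCommGroup E] [NormedSpace ℝ E] [FiniteDimensional ℝ E]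
  [MeasurableSpace E] [BorelSpace E] {μ : Measure E} [μ.IsAddHaarMeasure]

theorem lintegral_comp_add_smul {B : E → ℝ≥0∞} (hB : Measurable B) (x : E) {τ : ℝ} (hτ : τ ≠ 0) :
    ∫⁻ y, B (x + τ • y) ∂μ =
      ENNReal.ofReal |(τ ^ Module.finrank ℝ E)⁻¹| * ∫⁻ y, B y ∂μ := by
  have h1 : ∫⁻ y, B (x + τ • y) ∂μ = ∫⁻ y, B (x + y) ∂(μ.map (τ • ·)) := by
    rw [lintegral_map (by fun_prop) (by fun_prop)]
  rw [h1, Measure.map_addHaar_smul μ hτ, lintegral_smul_measure,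
    lintegral_add_left_eq_self, smul_eq_mul]

/-- Half of the weak Young inequality: the region where the inner function is the smaller one. -/
theorem lintegral_lintegral_truncated_le {τ : ℝ} (hτ : τ ≠ 0) {r : ℝ} (hr : 1 < r) {a b : ℝ}
    (ha : 0 ≤ a) (hb : 1 - r⁻¹ < b) (hb1 : b < 1) (hab : a + b + r⁻¹ = 2)
    {A B : E → ℝ≥0∞} (hA : Measurable A) (hB : Measurable B)
    (hA1 : ∫⁻ x, A x ∂μ ≤ 1) (hB1 : ∫⁻ x, B x ∂μ ≤ 1)
    {φ : E → ℝ} (hφ : Measurable φ) (hφ0 : ∀ x, 0 ≤ φ x) {W : ℝ≥0}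
    (hW : ∀ γ : ℝ, 0 < γ → μ {x | γ < φ x} ≤ ENNReal.ofReal ((W / γ) ^ r)) :
    ∫⁻ x, A x ^ a * ∫⁻ y, (if B (x + τ • y) ≤ A x then B (x + τ • y) ^ b else 0) *
        ENNReal.ofReal (φ y) ∂μ ∂μ ≤
      (1 + Real.toNNReal |(τ ^ Module.finrank ℝ E)⁻¹| : ℝ≥0) *
        ENNReal.ofReal (weakPairingConst r b) * W := by
  -- The summand 1 only ensures `1 ≤ K`.
  set K : ℝ≥0 := 1 + Real.toNNReal |(τ ^ Module.finrank ℝ E)⁻¹| with hK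
  have hBK : ∀ x, ∫⁻ y, B (x + τ • y) ∂μ ≤ K := fun x ↦ by
    rw [lintegral_comp_add_smul hB x hτ]
    refine (mul_le_of_le_one_right' hB1).trans ?_
    rw [ENNReal.ofReal, hK]
    exact_mod_cast le_add_self
  -- Truncating at `N = A x` yields the power `b - (1 - 1 / r)` of `A x`, which together with `a`
  -- makes 1.
  calc _ ≤ ∫⁻ x, A x ^ a * (K * ENNReal.ofReal (weakPairingConst r b) * W *
          A x ^ (b - (1 - r⁻¹))) ∂μ := by
        refine lintegral_mono fun x ↦ ?_
        gcongr
        exact lintegral_truncated_mul_le (B := fun y ↦ B (x + τ • y)) (by fun_prop)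
          le_self_add (hBK x) hφ hφ0 hr hW hb hb1 (A x)
    _ = ∫⁻ x, K * ENNReal.ofReal (weakPairingConst r b) * W * A x ∂μ := by
        refine lintegral_congr fun x ↦ ?_
        rw [mul_left_comm, ← ENNReal.rpow_add_of_nonneg _ _ ha (by linarith),
          show a + (b - (1 - r⁻¹)) = 1 by linarith, ENNReal.rpow_one]
    _ ≤ _ := by
        rw [lintegral_const_mul _ hA]
        exact mul_le_of_le_one_right' hA1

/-- The dual form of the weak Young inequality. -/
theorem exists_weak_young {θ : ℝ} (hθ : θ ≠ 0) {r : ℝ} (hr : 1 < r) {a b : ℝ}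
    (ha : 1 - r⁻¹ < a) (ha1 : a < 1) (hb : 1 - r⁻¹ < b) (hb1 : b < 1) (hab : a + b + r⁻¹ = 2) :
    ∃ C : ℝ≥0, ∀ (H F : E → ℝ≥0∞), Measurable H → Measurable F → ∫⁻ x, H x ∂μ ≤ 1 →
      ∫⁻ x, F x ∂μ ≤ 1 → ∀ (φ : E → ℝ), Measurable φ → (∀ x, 0 ≤ φ x) → ∀ W : ℝ≥0,
      (∀ γ : ℝ, 0 < γ → μ {x | γ < φ x} ≤ ENNReal.ofReal ((W / γ) ^ r)) →
      ∫⁻ x, ∫⁻ y, H x ^ a * F (x - θ • y) ^ b * ENNReal.ofReal (φ y) ∂μ ∂μ ≤ C * W := by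
  have hri : r⁻¹ < 1 := inv_lt_one_of_one_lt₀ hr
  refine ⟨(1 + Real.toNNReal |((-θ) ^ Module.finrank ℝ E)⁻¹|) * (weakPairingConst r b).toNNReal +
    (1 + Real.toNNReal |(θ ^ Module.finrank ℝ E)⁻¹|) * (weakPairingConst r a).toNNReal,
    fun H F hHm hFm hH hF φ hφ hφ0 W hW ↦ ?_⟩
  have h1 := lintegral_lintegral_truncated_le (neg_ne_zero.2 hθ) hr (by linarith) hb hb1 hab
    hHm hFm hH hF hφ hφ0 hW
  have h2 := lintegral_lintegral_truncated_le hθ hr (by linarith) ha ha1 (by linarith)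
    hFm hHm hF hH hφ hφ0 hW
  have hm1 : Measurable fun z : E × E ↦ H z.1 ^ a *
      ((if F (z.1 + -θ • z.2) ≤ H z.1 then F (z.1 + -θ • z.2) ^ b else 0) *
        ENNReal.ofReal (φ z.2)) := by
    refine Measurable.mul (by fun_prop) (Measurable.mul (Measurable.ite ?_ ?_ ?_) ?_)
    · exact measurableSet_le (by fun_prop) (by fun_prop)
    all_goals fun_prop
  have hm2 : Measurable fun z : E × E ↦ F z.1 ^ b *
      ((if H (z.1 + θ • z.2) ≤ F z.1 then H (z.1 + θ • z.2) ^ a else 0) *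
        ENNReal.ofReal (φ z.2)) := by
    refine Measurable.mul (by fun_prop) (Measurable.mul (Measurable.ite ?_ ?_ ?_) ?_)
    · exact measurableSet_le (by fun_prop) (by fun_prop)
    all_goals fun_prop
  have hm2' : Measurable fun z : E × E ↦ F (z.1 + -θ • z.2) ^ b *
      ((if H z.1 ≤ F (z.1 + -θ • z.2) then H z.1 ^ a else 0) * ENNReal.ofReal (φ z.2)) := by
    refine Measurable.mul (by fun_prop) (Measurable.mul (Measurable.ite ?_ ?_ ?_) ?_)
    · exact measurableSet_le (by fun_prop) (by fun_prop)
    all_goals fun_prop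
  have h1' : ∫⁻ x, ∫⁻ y, H x ^ a * ((if F (x + -θ • y) ≤ H x then F (x + -θ • y) ^ b else 0) *
      ENNReal.ofReal (φ y)) ∂μ ∂μ ≤ (1 + Real.toNNReal |((-θ) ^ Module.finrank ℝ E)⁻¹| : ℝ≥0) *
        ENNReal.ofReal (weakPairingConst r b) * W := by
    refine le_trans (le_of_eq (lintegral_congr fun x ↦ ?_)) h1
    refine lintegral_const_mul _ (Measurable.mul (Measurable.ite ?_ ?_ ?_) ?_)
    · exact measurableSet_le (by fun_prop) (by fun_prop)
    all_goals fun_prop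
  -- After Tonelli, the translation `x ↦ x + θ • y` exchanges the roles of `H` and `F`.
  have h2' : ∫⁻ x, ∫⁻ y, F (x + -θ • y) ^ b *
      ((if H x ≤ F (x + -θ • y) then H x ^ a else 0) * ENNReal.ofReal (φ y)) ∂μ ∂μ ≤
      (1 + Real.toNNReal |(θ ^ Module.finrank ℝ E)⁻¹| : ℝ≥0) *
        ENNReal.ofReal (weakPairingConst r a) * W := by
    rw [lintegral_lintegral_swap hm2'.aemeasurable]
    refine le_trans (le_of_eq ?_) h2
    calc _ = ∫⁻ y, ∫⁻ x, F x ^ b * ((if H (x + θ • y) ≤ F x then H (x + θ • y) ^ a else 0) *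
            ENNReal.ofReal (φ y)) ∂μ ∂μ := by
          refine lintegral_congr fun y ↦ ?_
          rw [← lintegral_add_right_eq_self _ (θ • y)]
          simp
      _ = ∫⁻ x, ∫⁻ y, F x ^ b * ((if H (x + θ • y) ≤ F x then H (x + θ • y) ^ a else 0) *
            ENNReal.ofReal (φ y)) ∂μ ∂μ := (lintegral_lintegral_swap hm2.aemeasurable).symm
      _ = _ := by
          refine lintegral_congr fun x ↦ ?_
          refine lintegral_const_mul _ (Measurable.mul (Measurable.ite ?_ ?_ ?_) ?_)
          · exact measurableSet_le (by fun_prop) (by fun_prop)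
          all_goals fun_prop
  have hpt : ∀ x y, H x ^ a * F (x - θ • y) ^ b * ENNReal.ofReal (φ y) ≤
      H x ^ a * ((if F (x + -θ • y) ≤ H x then F (x + -θ • y) ^ b else 0) *
        ENNReal.ofReal (φ y)) +
      F (x + -θ • y) ^ b * ((if H x ≤ F (x + -θ • y) then H x ^ a else 0) *
        ENNReal.ofReal (φ y)) := fun x y ↦ by
    rw [neg_smul, ← sub_eq_add_neg]
    rcases le_total (F (x - θ • y)) (H x) with h | h
    · rw [if_pos h, mul_assoc]
      exact le_self_add
    · rw [if_pos h, mul_comm (H x ^ a), mul_assoc]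
      exact le_add_self
  calc _ ≤ ∫⁻ x, ((∫⁻ y, H x ^ a * ((if F (x + -θ • y) ≤ H x then F (x + -θ • y) ^ b else 0) *
        ENNReal.ofReal (φ y)) ∂μ) +
      ∫⁻ y, F (x + -θ • y) ^ b * ((if H x ≤ F (x + -θ • y) then H x ^ a else 0) *
        ENNReal.ofReal (φ y)) ∂μ) ∂μ := by
        refine lintegral_mono fun x ↦ ?_
        exact (lintegral_mono (hpt x)).trans_eq
          (lintegral_add_left (hm1.comp (measurable_prodMk_left (x := x))) _)
    _ ≤ _ := by
        rw [lintegral_add_left hm1.lintegral_prod_right']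
        refine (add_le_add h1' h2').trans_eq ?_
        push_cast
        simp only [ENNReal.ofReal]
        ring

end Young

theorem ae_lt_top_of_eLpNorm_lt_top {α : Type*} [MeasurableSpace α] {μ : Measure α}
    {v : α → ℝ≥0∞} (hv : Measurable v) {q : ℝ≥0∞} (hq : q ≠ 0) (h : eLpNorm v q μ < ∞) :
    ∀ᵐ x ∂μ, v x < ∞ := by
  rcases eq_or_ne q ∞ with rfl | hqtop
  · filter_upwards [ae_le_eLpNormEssSup (f := v) (μ := μ)] with x hx
    exact hx.trans_lt (by simpa using h)
  · have h1 := lintegral_rpow_enorm_lt_top_of_eLpNorm_lt_top hq hqtop h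
    filter_upwards [ae_lt_top (by simpa using hv.pow_const _) h1.ne] with x hx
    simpa using (ENNReal.rpow_lt_top_iff_of_pos (ENNReal.toReal_pos hq hqtop)).1 hx

/-! ### Multilinear dual forms. -/

section Haar

variable {E : Type*} [NormedAddCommGroup E] [NormedSpace ℝ E] [FiniteDimensional ℝ E]
  [MeasurableSpace E] [BorelSpace E] {μ : Measure E} [μ.IsAddHaarMeasure]

theorem quasiMeasurePreserving_sub_smul {θ : ℝ} (hθ : θ ≠ 0) (x : E) :
    Measure.QuasiMeasurePreserving (fun y ↦ x - θ • y) μ μ :=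
  (Measure.measurePreserving_sub_left μ x).quasiMeasurePreserving.comp
    (Measure.quasiMeasurePreserving_smul μ hθ)

theorem quasiMeasurePreserving_prod_sub_smul {θ : ℝ} (hθ : θ ≠ 0) :
    Measure.QuasiMeasurePreserving (fun z : E × E ↦ z.1 - θ • z.2) (μ.prod μ) μ :=
  QuasiMeasurePreserving.prod_of_right (by fun_prop)
    (.of_forall fun x ↦ quasiMeasurePreserving_sub_smul hθ x)

/-- The dual form of the multilinear weak Young inequality; by Hölder's inequality it follows from
the case of a single factor. -/
theorem exists_weak_young_prod {m : ℕ} {θ : Fin m → ℝ} (hθ : ∀ j, θ j ≠ 0) {r : ℝ} (hr : 1 < r)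
    {a b : ℝ} (ha : 1 - r⁻¹ < a) (ha1 : a < 1) (hb : 1 - r⁻¹ < b) (hb1 : b < 1)
    (hab : a + b + r⁻¹ = 2) {c : Fin m → ℝ} (hc0 : ∀ j, 0 ≤ c j) (hc : ∑ j, c j = b) :
    ∃ C : ℝ≥0, ∀ (H : E → ℝ≥0∞) (F : Fin m → E → ℝ≥0∞), Measurable H → (∀ j, Measurable (F j)) →
      ∫⁻ x, H x ∂μ ≤ 1 → (∀ j, ∫⁻ x, F j x ∂μ ≤ 1) →
      ∀ (φ : E → ℝ), Measurable φ → (∀ x, 0 ≤ φ x) → ∀ W : ℝ≥0,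
      (∀ γ : ℝ, 0 < γ → μ {x | γ < φ x} ≤ ENNReal.ofReal ((W / γ) ^ r)) →
      ∫⁻ z : E × E, H z.1 ^ a * ((∏ j, F j (z.1 - θ j • z.2) ^ c j) * ENNReal.ofReal (φ z.2))
        ∂(μ.prod μ) ≤ C * W := by
  have hri : r⁻¹ < 1 := inv_lt_one_of_one_lt₀ hr
  have hb0 : 0 < b := by linarith
  choose C hC using fun j ↦ exists_weak_young (μ := μ) (hθ j) hr ha ha1 hb hb1 hab
  refine ⟨∑ j, C j, fun H F hHm hFm hH hF φ hφ hφ0 W hW ↦ ?_⟩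
  have hw0 : ∀ j, 0 ≤ c j / b := fun j ↦ div_nonneg (hc0 j) hb0.le
  have hw1 : ∑ j, c j / b = 1 := by rw [← Finset.sum_div, hc, div_self hb0.ne']
  -- The integrand is a geometric mean, with weights `c j / b`, of integrands that each involve one
  -- `F j` to the full power `b`.
  have hfac : ∀ z : E × E,
      H z.1 ^ a * ((∏ j, F j (z.1 - θ j • z.2) ^ c j) * ENNReal.ofReal (φ z.2)) =
      ∏ j, (H z.1 ^ a * F j (z.1 - θ j • z.2) ^ b * ENNReal.ofReal (φ z.2)) ^ (c j / b) :=
    fun z ↦ by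
    have h1 : ∀ j, (H z.1 ^ a * F j (z.1 - θ j • z.2) ^ b * ENNReal.ofReal (φ z.2)) ^ (c j / b) =
        (H z.1 ^ a * ENNReal.ofReal (φ z.2)) ^ (c j / b) * F j (z.1 - θ j • z.2) ^ c j := fun j ↦ by
      rw [mul_right_comm, ENNReal.mul_rpow_of_nonneg _ _ (hw0 j), ← ENNReal.rpow_mul (F j _),
        mul_div_cancel₀ _ hb0.ne']
    simp_rw [h1]
    rw [Finset.prod_mul_distrib, ← ENNReal.rpow_sum_of_nonneg _ _ fun j _ ↦ hw0 j, hw1,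
      ENNReal.rpow_one]
    ring
  simp_rw [hfac]
  have hm : ∀ j, Measurable fun z : E × E ↦
      H z.1 ^ a * F j (z.1 - θ j • z.2) ^ b * ENNReal.ofReal (φ z.2) := fun j ↦ by fun_prop
  refine (ENNReal.lintegral_prod_norm_pow_le Finset.univ (fun j _ ↦ (hm j).aemeasurable) hw1
    fun j _ ↦ hw0 j).trans ?_
  calc ∏ j, (∫⁻ z : E × E, H z.1 ^ a * F j (z.1 - θ j • z.2) ^ b * ENNReal.ofReal (φ z.2)
          ∂(μ.prod μ)) ^ (c j / b)
      ≤ ∏ j, ((∑ i, C i : ℝ≥0) * W : ℝ≥0∞) ^ (c j / b) := by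
        refine Finset.prod_le_prod' fun j _ ↦ ENNReal.rpow_le_rpow ?_ (hw0 j)
        rw [lintegral_prod _ (hm j).aemeasurable]
        refine (hC j H (F j) hHm (hFm j) hH (hF j) φ hφ hφ0 W hW).trans ?_
        gcongr
        exact Finset.single_le_sum (f := C) (fun i _ ↦ zero_le) (Finset.mem_univ j)
    _ = _ := by
        rw [← ENNReal.rpow_sum_of_nonneg _ _ fun j _ ↦ hw0 j, hw1, ENNReal.rpow_one]

/-- The dual form of the multilinear Young inequality. -/
theorem exists_young_prod {m : ℕ} (hm : 1 ≤ m) {θ : Fin m → ℝ} (hθ0 : ∀ j, θ j ≠ 0)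
    (hθ : Function.Injective θ) {a s : ℝ} (ha0 : 0 ≤ a) (ha1 : a ≤ 1) (hs0 : 0 ≤ s) (hs1 : s ≤ 1)
    {c : Fin m → ℝ} (hc0 : ∀ j, 0 ≤ c j) (hc1 : ∀ j, c j ≤ 1) (hc : a + s + ∑ j, c j = 2) :
    ∃ K : ℝ≥0, ∀ (H G : E → ℝ≥0∞) (F : Fin m → E → ℝ≥0∞), Measurable H → Measurable G →
      (∀ j, Measurable (F j)) → ∫⁻ x, H x ∂μ ≤ 1 → ∫⁻ x, G x ∂μ ≤ 1 →
      (∀ j, ∫⁻ x, F j x ∂μ ≤ 1) →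
      ∫⁻ z : E × E, H z.1 ^ a * ((∏ j, F j (z.1 - θ j • z.2) ^ c j) * G z.2 ^ s) ∂(μ.prod μ) ≤
        K := by
  -- The indices `none`, `some none`, `some (some j)` carry the forms `x`, `y`, `x - θ j • y`. Their
  -- determinants are, up to sign, 1, `θ j` and `θ i - θ j`.
  let A : Option (Option (Fin m)) → ℝ := fun i ↦ i.elim 1 fun i ↦ i.elim 0 fun _ ↦ 1
  let B : Option (Option (Fin m)) → ℝ := fun i ↦ i.elim 0 fun i ↦ i.elim 1 fun j ↦ -θ j
  let c' : Option (Option (Fin m)) → ℝ := fun i ↦ i.elim a fun i ↦ i.elim s c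
  have hAB : ∀ i j, i ≠ j → A i * B j - A j * B i ≠ 0 := by
    rintro (_ | _ | i) (_ | _ | j) hij <;> simp_all [A, B]
    intro h
    refine hij (hθ ?_)
    linarith
  obtain ⟨K, hK⟩ := exists_lintegral_prod_rpow_le μ (by simp; omega) hAB (c := c')
    (by rintro (_ | _ | j) <;> simp [c', *]) (by rintro (_ | _ | j) <;> simp [c', *])
    (by simp [Fintype.sum_option, c', ← hc, add_assoc])
  refine ⟨K, fun H G F hHm hGm hFm hH hG hF ↦ ?_⟩
  have := hK (fun i ↦ i.elim H fun i ↦ i.elim G F) (by rintro (_ | _ | j) <;> simp [*])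
    (by rintro (_ | _ | j) <;> simp [*])
  refine (lintegral_congr fun z ↦ ?_).trans_le this
  simp [Fintype.prod_option, A, B, c', mul_comm, sub_eq_add_neg]

end Haar

/-! ### From the dual form to the convolution. -/

theorem enorm_multiConvIntegrand {d m : ℕ} (θ : Fin m → ℝ)
    (f : Fin m → EuclideanSpace ℝ (Fin d) → ℂ) (g : EuclideanSpace ℝ (Fin d) → ℂ)
    (x y : EuclideanSpace ℝ (Fin d)) :
    ‖multiConvIntegrand θ f g x y‖ₑ = (∏ j, ‖f j (x - θ j • y)‖ₑ) * ‖g y‖ₑ := by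
  simp [multiConvIntegrand, enorm_eq_nnnorm, nnnorm_prod]

/-- Bounds for the dual form with normalized functions give bounds for `multiConv`. -/
theorem multiConv_bounds_of_dual {d m : ℕ} {θ : Fin m → ℝ} (hθ : ∀ j, θ j ≠ 0)
    {P : Fin m → ℝ≥0∞} (hP : ∀ j, P j ≠ 0) {q : ℝ≥0∞} (hq : 1 ≤ q)
    {f : Fin m → EuclideanSpace ℝ (Fin d) → ℂ} (hf : ∀ j, MemLp (f j) (P j) volume)
    {g : EuclideanSpace ℝ (Fin d) → ℂ} (hg : AEStronglyMeasurable g volume)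
    {G : EuclideanSpace ℝ (Fin d) → ℝ≥0∞} (hG : Measurable G) (hgG : ∀ᵐ y, ‖g y‖ₑ ≤ G y)
    {D : ℝ≥0∞} (hD : D ≠ ∞)
    (h : ∀ (H : EuclideanSpace ℝ (Fin d) → ℝ≥0∞) (F : Fin m → EuclideanSpace ℝ (Fin d) → ℝ≥0∞),
      Measurable H → (∀ j, Measurable (F j)) → ∫⁻ x, H x ≤ 1 → (∀ j, ∫⁻ x, F j x ≤ 1) →
      ∫⁻ z : EuclideanSpace ℝ (Fin d) × EuclideanSpace ℝ (Fin d), H z.1 ^ (1 - q⁻¹.toReal) *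
        ((∏ j, F j (z.1 - θ j • z.2) ^ (P j)⁻¹.toReal) * G z.2) ∂(volume.prod volume) ≤ D) :
    (∀ᵐ x, Integrable (multiConvIntegrand θ f g x) volume) ∧ MemLp (multiConv θ f g) q volume ∧
      eLpNorm (multiConv θ f g) q volume ≤ (∏ j, eLpNorm (f j) (P j) volume) * D := by
  choose F hFm hF hfF using fun j ↦ (hf j).exists_enorm_le_mul_rpow (hP j)
  set N : ℝ≥0∞ := ∏ j, eLpNorm (f j) (P j) volume with hN
  have hNtop : N ≠ ∞ := ENNReal.prod_ne_top fun j _ ↦ (hf j).2.ne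
  let k : EuclideanSpace ℝ (Fin d) × EuclideanSpace ℝ (Fin d) → ℝ≥0∞ := fun z ↦
    (∏ j, F j (z.1 - θ j • z.2) ^ (P j)⁻¹.toReal) * G z.2
  have hk : Measurable k := by fun_prop
  -- This holds for every `x`: as `θ j ≠ 0`, the map `y ↦ x - θ j • y` pulls null sets back to null
  -- sets.
  have hbound : ∀ x, ∀ᵐ y, ‖multiConvIntegrand θ f g x y‖ₑ ≤ N * k (x, y) := fun x ↦ by
    have h1 : ∀ j, ∀ᵐ y, ‖f j (x - θ j • y)‖ₑ ≤
        eLpNorm (f j) (P j) volume * F j (x - θ j • y) ^ (P j)⁻¹.toReal := fun j ↦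
      (quasiMeasurePreserving_sub_smul (hθ j) x).ae (hfF j)
    filter_upwards [ae_all_iff.2 h1, hgG] with y hy1 hy2
    rw [enorm_multiConvIntegrand]
    calc _ ≤ (∏ j, eLpNorm (f j) (P j) volume * F j (x - θ j • y) ^ (P j)⁻¹.toReal) * G y := by
          gcongr with j
          exact hy1 j
      _ = N * k (x, y) := by
          rw [Finset.prod_mul_distrib, mul_assoc]
  have hv : Measurable fun x ↦ ∫⁻ y, k (x, y) := hk.lintegral_prod_right'
  have hvD : eLpNorm (fun x ↦ ∫⁻ y, k (x, y)) q volume ≤ D := by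
    refine eLpNorm_le_of_forall_dual hv hq fun H hHm hH ↦
      le_trans (le_of_eq ?_) (h H F hHm hFm hH hF)
    rw [lintegral_prod _ (by fun_prop)]
    exact lintegral_congr fun x ↦ (lintegral_const_mul _ (hk.comp measurable_prodMk_left)).symm
  have hint : ∀ x, ∫⁻ y, ‖multiConvIntegrand θ f g x y‖ₑ ≤ N * ∫⁻ y, k (x, y) := fun x ↦
    (lintegral_mono_ae (hbound x)).trans_eq
      (lintegral_const_mul _ (hk.comp measurable_prodMk_left))
  have hmeas : AEStronglyMeasurable (fun z : EuclideanSpace ℝ (Fin d) × EuclideanSpace ℝ (Fin d) ↦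
      multiConvIntegrand θ f g z.1 z.2) (volume.prod volume) := by
    refine AEStronglyMeasurable.mul ?_ hg.comp_snd
    refine Finset.aestronglyMeasurable_fun_prod _ fun j _ ↦ ?_
    exact (hf j).1.comp_quasiMeasurePreserving (quasiMeasurePreserving_prod_sub_smul (hθ j))
  have hmeas_conv : AEStronglyMeasurable (multiConv θ f g) volume := hmeas.integral_prod_right'
  have hnorm : eLpNorm (multiConv θ f g) q volume ≤ N * D := by
    have h1 : eLpNorm (multiConv θ f g) q volume ≤
        N.toNNReal • eLpNorm (fun x ↦ ∫⁻ y, k (x, y)) q volume := by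
      refine eLpNorm_le_nnreal_smul_eLpNorm_of_ae_le_mul' (.of_forall fun x ↦ ?_) q
      rw [ENNReal.coe_toNNReal hNtop]
      exact (enorm_integral_le_lintegral_enorm _).trans (hint x)
    rw [ENNReal.smul_def, ENNReal.coe_toNNReal hNtop, smul_eq_mul] at h1
    exact h1.trans (by gcongr)
  refine ⟨?_, ⟨hmeas_conv, hnorm.trans_lt (by finiteness)⟩, hnorm⟩
  filter_upwards [ae_lt_top_of_eLpNorm_lt_top hv (by positivity) (hvD.trans_lt hD.lt_top)]
    with x hx
  refine ⟨?_, (hint x).trans_lt (ENNReal.mul_lt_top hNtop.lt_top hx)⟩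
  refine AEStronglyMeasurable.mul ?_ hg
  refine Finset.aestronglyMeasurable_fun_prod _ fun j _ ↦ ?_
  exact (hf j).1.comp_quasiMeasurePreserving (quasiMeasurePreserving_sub_smul (hθ j) x)

theorem volume_lt_norm_le_of_weakLpNorm_le {d : ℕ} {g : EuclideanSpace ℝ (Fin d) → ℂ} {s : ℝ}
    (hs : 0 < s) {W : ℝ≥0} (hW : weakLpNorm g s ≤ W) {γ : ℝ} (hγ : 0 < γ) :
    volume {x | γ < ‖g x‖} ≤ ENNReal.ofReal ((W / γ) ^ s) := by
  have h1 : ENNReal.ofReal γ * volume {x | γ < ‖g x‖} ^ (1 / s) ≤ W :=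
    (le_iSup₂ (f := fun (α : ℝ) (_ : 0 < α) ↦
      ENNReal.ofReal α * volume {x | α < ‖g x‖} ^ (1 / s)) γ hγ).trans hW
  have h2 : volume {x | γ < ‖g x‖} ^ (1 / s) ≤ W / ENNReal.ofReal γ := by
    rw [ENNReal.le_div_iff_mul_le (by simp [hγ]) (by simp), mul_comm]
    exact h1
  rw [one_div, ENNReal.rpow_inv_le_iff hs] at h2
  rwa [← ENNReal.ofReal_rpow_of_nonneg (by positivity) hs.le, ENNReal.ofReal_div_of_pos hγ,
    ENNReal.ofReal_coe_nnreal]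

/-! ### Exponent ranges and the main theorem. -/

/-- In reciprocals every condition is linear, and the hypotheses reduce to `1/p = 1/q + 1/r'` with
`1/r + 1/r' = 1`. -/
theorem ENNReal.exponent_range_iff {p q r : ℝ≥0∞} (hr : 1 < r) (hp0 : p ≠ 0)
    (hq : q⁻¹ + 1 = p⁻¹ + r⁻¹) :
    ((r.conjExponent / (1 + r.conjExponent) ≤ p ∧ p ≤ r.conjExponent) ↔ 1 ≤ q) ∧
    ((1 < p ∧ p < r.conjExponent) ↔ (r < q ∧ q < ∞)) ∧
    ((r.conjExponent / (1 + r.conjExponent) ≤ p ∧ p ≤ 1) ↔ (1 ≤ q ∧ q ≤ r)) := by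
  have hconj : r⁻¹ + r.conjExponent⁻¹ = 1 :=
    (ENNReal.HolderConjugate.conjExponent hr.le).inv_add_inv_eq_one
  have hc0 : r.conjExponent ≠ 0 := by simp [ENNReal.conjExponent]
  have hctop : r.conjExponent ≠ ∞ := by
    simp [ENNReal.conjExponent, tsub_eq_zero_iff_le, hr]
  have hdiv : r.conjExponent / (1 + r.conjExponent) ≤ p ↔ p⁻¹ ≤ 1 + r.conjExponent⁻¹ := by
    rw [← ENNReal.inv_le_inv, ENNReal.inv_div (Or.inr hctop) (Or.inr hc0), ENNReal.add_div,
      ENNReal.div_self hc0 hctop, one_div, add_comm]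
  rw [hdiv, ← ENNReal.inv_le_inv (a := r.conjExponent), ← ENNReal.inv_le_one (a := q),
    ← ENNReal.inv_lt_one (a := p), ← ENNReal.inv_lt_inv (a := r.conjExponent),
    ← ENNReal.inv_lt_inv (a := q), ← ENNReal.one_le_inv (a := p), ← ENNReal.inv_le_inv (a := r),
    lt_top_iff_ne_top, ← ENNReal.inv_pos]
  have hx : p⁻¹ ≠ ∞ := by simpa using hp0
  have hz : r⁻¹ ≠ ∞ := by simpa using (zero_lt_one.trans hr).ne'
  have ht : r.conjExponent⁻¹ ≠ ∞ := by simpa using hc0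
  have hy : q⁻¹ ≠ ∞ := fun h ↦ by
    rw [h, top_add] at hq
    exact ENNReal.add_ne_top.2 ⟨hx, hz⟩ hq.symm
  generalize p⁻¹ = x at *
  generalize q⁻¹ = y at *
  generalize r⁻¹ = z at *
  generalize r.conjExponent⁻¹ = t at *
  lift x to ℝ≥0 using hx
  lift y to ℝ≥0 using hy
  lift z to ℝ≥0 using hz
  lift t to ℝ≥0 using ht
  norm_cast at *
  simp only [← NNReal.coe_le_coe, ← NNReal.coe_lt_coe, ← NNReal.coe_inj, NNReal.coe_add,
    NNReal.coe_one, NNReal.coe_zero] at *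
  refine ⟨⟨fun h ↦ by linarith, fun h ↦ ⟨by linarith, ?_⟩⟩,
    ⟨fun h ↦ ⟨by linarith, by linarith⟩, fun h ↦ ⟨by linarith, by linarith⟩⟩,
    ⟨fun h ↦ ⟨by linarith, by linarith⟩, fun h ↦ ⟨by linarith, by linarith⟩⟩⟩
  linarith [NNReal.coe_nonneg y]

theorem theorem1p3 (d m : ℕ) (hd : 1 ≤ d) (hm : 1 ≤ m)
    (θ : Fin m → ℝ) (hθ0 : ∀ j, θ j ≠ 0) (hθ : Function.Injective θ)
    (r : ℝ≥0∞) (hr : 1 < r)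
    (P : Fin m → ℝ≥0∞) (hP : ∀ j, 1 ≤ P j)
    (p q : ℝ≥0∞) (hp : p⁻¹ = ∑ j, (P j)⁻¹) (hq : q⁻¹ + 1 = p⁻¹ + r⁻¹) :
    -- the stated equivalences between the ranges of `p` and of `q`
    ((r.conjExponent / (1 + r.conjExponent) ≤ p ∧ p ≤ r.conjExponent) ↔ 1 ≤ q) ∧
    (r < ∞ → ((1 < p ∧ p < r.conjExponent) ↔ (r < q ∧ q < ∞))) ∧
    ((r.conjExponent / (1 + r.conjExponent) ≤ p ∧ p ≤ 1) ↔ (1 ≤ q ∧ q ≤ r)) ∧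
    -- the constant depends on `d, m, θ, P, r` only, as `p` and `q` are determined by `P` and `r`
    ∃ C : ℝ≥0,
      -- (a)
      (r < ∞ → 1 < p → p < r.conjExponent →
        ∀ (f : Fin m → EuclideanSpace ℝ (Fin d) → ℂ) (g : EuclideanSpace ℝ (Fin d) → ℂ),
          (∀ j, MemLp (f j) (P j) volume) → MemWeakLp g r.toReal →
            (∀ᵐ x, Integrable (multiConvIntegrand θ f g x) volume) ∧
            MemLp (multiConv θ f g) q volume ∧
            eLpNorm (multiConv θ f g) q volume ≤
              C * (∏ j, eLpNorm (f j) (P j) volume) * weakLpNorm g r.toReal) ∧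
      -- (b)
      (r.conjExponent / (1 + r.conjExponent) ≤ p → p ≤ 1 →
        ∀ (f : Fin m → EuclideanSpace ℝ (Fin d) → ℂ) (g : EuclideanSpace ℝ (Fin d) → ℂ),
          (∀ j, MemLp (f j) (P j) volume) → MemLp g r volume →
            (∀ᵐ x, Integrable (multiConvIntegrand θ f g x) volume) ∧
            MemLp (multiConv θ f g) q volume ∧
            eLpNorm (multiConv θ f g) q volume ≤
              C * (∏ j, eLpNorm (f j) (P j) volume) * eLpNorm g r volume) := by
  have hPtop : ∀ j, (P j)⁻¹ ≠ ∞ := fun j ↦ by simpa using (zero_lt_one.trans_le (hP j)).ne'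
  have hp0 : p ≠ 0 := by
    rw [← ENNReal.inv_ne_top, hp]
    exact ENNReal.sum_ne_top.2 fun j _ ↦ hPtop j
  have hr0 : r ≠ 0 := (zero_lt_one.trans hr).ne'
  obtain ⟨h1, h2, h3⟩ := ENNReal.exponent_range_iff hr hp0 hq
  refine ⟨h1, fun _ ↦ h2, h3, ?_⟩
  have hqtop : 1 ≤ q → q⁻¹ ≠ ∞ := fun h ↦ by simpa using (zero_lt_one.trans_le h).ne'
  have hpsum : p⁻¹.toReal = ∑ j, (P j)⁻¹.toReal := by
    rw [hp, ENNReal.toReal_sum fun j _ ↦ hPtop j]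
  have hsum : 1 ≤ q → q⁻¹.toReal + 1 = p⁻¹.toReal + r⁻¹.toReal := fun h ↦ by
    rw [← ENNReal.toReal_add (by simpa using hp0) (by simpa using hr0), ← hq,
      ENNReal.toReal_add (hqtop h) ENNReal.one_ne_top, ENNReal.toReal_one]
  have hle : ∀ t : ℝ≥0∞, 1 ≤ t → t⁻¹.toReal ≤ 1 := fun t ht ↦ by
    rw [← ENNReal.toReal_one]
    exact ENNReal.toReal_mono ENNReal.one_ne_top (ENNReal.inv_le_one.2 ht)
  have hPne : ∀ j, P j ≠ 0 := fun j ↦ (zero_lt_one.trans_le (hP j)).ne'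
  have weak : ∃ C : ℝ≥0, r < ∞ → 1 < p → p < r.conjExponent →
      ∀ (f : Fin m → EuclideanSpace ℝ (Fin d) → ℂ) (g : EuclideanSpace ℝ (Fin d) → ℂ),
        (∀ j, MemLp (f j) (P j) volume) → MemWeakLp g r.toReal →
          (∀ᵐ x, Integrable (multiConvIntegrand θ f g x) volume) ∧
          MemLp (multiConv θ f g) q volume ∧
          eLpNorm (multiConv θ f g) q volume ≤
            C * (∏ j, eLpNorm (f j) (P j) volume) * weakLpNorm g r.toReal := by
    by_cases hcond : r < ∞ ∧ 1 < p ∧ p < r.conjExponent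
    swap
    -- The constant precedes the range conditions; outside the range any value will do.
    · exact ⟨0, fun ha hb hc ↦ absurd ⟨ha, hb, hc⟩ hcond⟩
    obtain ⟨hrtop, hp1, hpr⟩ := hcond
    obtain ⟨hrq, hqlt⟩ := h2.1 ⟨hp1, hpr⟩
    have hq1 : 1 ≤ q := (hr.trans hrq).le
    have hr1 : 1 < r.toReal := by
      rw [← ENNReal.toReal_one]
      exact (ENNReal.toReal_lt_toReal ENNReal.one_ne_top hrtop.ne).2 hr
    have hqr : q⁻¹.toReal < r.toReal⁻¹ := by
      rw [← ENNReal.toReal_inv]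
      exact (ENNReal.toReal_lt_toReal (hqtop hq1) (by simpa using hr0)).2
        (ENNReal.inv_lt_inv.2 hrq)
    have hq0 : 0 < q⁻¹.toReal :=
      ENNReal.toReal_pos (by simpa using hqlt.ne) (hqtop hq1)
    have hs := hsum hq1
    rw [ENNReal.toReal_inv r] at hs
    -- The four strict bounds on `a = 1 - 1/q` and `b = 1/p` say `r < q`, `q < ∞`, `p < r'` and `1 <
    -- p`.
    obtain ⟨C, hC⟩ := exists_weak_young_prod
      (μ := (volume : Measure (EuclideanSpace ℝ (Fin d)))) hθ0 hr1
      (a := 1 - q⁻¹.toReal) (b := p⁻¹.toReal) (by linarith) (by linarith) (by linarith)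
      (by linarith) (by linarith) (fun j ↦ ENNReal.toReal_nonneg) hpsum.symm
    refine ⟨C, fun _ _ _ f g hf hg ↦ ?_⟩
    obtain ⟨W, hW⟩ := WithTop.ne_top_iff_exists.1 hg.2.ne
    replace hW : (W : ℝ≥0∞) = weakLpNorm g r.toReal := hW
    have hmk : ∀ γ : ℝ, 0 < γ →
        volume {x | γ < ‖hg.1.mk g x‖} ≤ ENNReal.ofReal ((W / γ) ^ r.toReal) := fun γ hγ ↦ by
      refine le_trans (le_of_eq (measure_congr ?_))
        (volume_lt_norm_le_of_weakLpNorm_le (by linarith) hW.ge hγ)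
      filter_upwards [hg.1.ae_eq_mk] with x hx
      exact congrArg (fun t : ℂ ↦ γ < ‖t‖) hx.symm
    have key := multiConv_bounds_of_dual (D := C * W) hθ0 hPne hq1 hf hg.1
      (G := fun y ↦ ENNReal.ofReal ‖hg.1.mk g y‖)
      (hg.1.stronglyMeasurable_mk.measurable.norm.ennreal_ofReal)
      (by filter_upwards [hg.1.ae_eq_mk] with y hy; rw [← hy, ofReal_norm])
      (by finiteness) fun H F hHm hFm hH hF ↦ hC H F hHm hFm hH hF _
        hg.1.stronglyMeasurable_mk.measurable.norm (fun _ ↦ norm_nonneg _) W hmk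
    refine ⟨key.1, key.2.1, key.2.2.trans_eq ?_⟩
    rw [← hW]
    ring
  have strong : ∃ C : ℝ≥0, r.conjExponent / (1 + r.conjExponent) ≤ p → p ≤ 1 →
      ∀ (f : Fin m → EuclideanSpace ℝ (Fin d) → ℂ) (g : EuclideanSpace ℝ (Fin d) → ℂ),
        (∀ j, MemLp (f j) (P j) volume) → MemLp g r volume →
          (∀ᵐ x, Integrable (multiConvIntegrand θ f g x) volume) ∧
          MemLp (multiConv θ f g) q volume ∧
          eLpNorm (multiConv θ f g) q volume ≤
            C * (∏ j, eLpNorm (f j) (P j) volume) * eLpNorm g r volume := by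
    by_cases hcond : r.conjExponent / (1 + r.conjExponent) ≤ p ∧ p ≤ 1
    swap
    · exact ⟨0, fun ha hb ↦ absurd ⟨ha, hb⟩ hcond⟩
    obtain ⟨hq1, -⟩ := h3.1 hcond
    have hs := hsum hq1
    rw [hpsum] at hs
    obtain ⟨C, hC⟩ := exists_young_prod
      (μ := (volume : Measure (EuclideanSpace ℝ (Fin d)))) hm hθ0 hθ
      (a := 1 - q⁻¹.toReal) (s := r⁻¹.toReal) (by linarith [hle q hq1])
      (by linarith [ENNReal.toReal_nonneg (a := q⁻¹)]) ENNReal.toReal_nonneg (hle r hr.le)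
      (fun j ↦ ENNReal.toReal_nonneg) (fun j ↦ hle _ (hP j)) (by linarith)
    refine ⟨C, fun _ _ f g hf hg ↦ ?_⟩
    obtain ⟨G, hGm, hG, hgG⟩ := hg.exists_enorm_le_mul_rpow hr0
    have hgtop : eLpNorm g r volume ≠ ∞ := hg.2.ne
    have key := multiConv_bounds_of_dual (D := C * eLpNorm g r volume) hθ0 hPne hq1 hf hg.1
      (by fun_prop) hgG (by finiteness) fun H F hHm hFm hH hF ↦ by
        have hpt : ∀ z : EuclideanSpace ℝ (Fin d) × EuclideanSpace ℝ (Fin d),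
            H z.1 ^ (1 - q⁻¹.toReal) * ((∏ j, F j (z.1 - θ j • z.2) ^ (P j)⁻¹.toReal) *
              (eLpNorm g r volume * G z.2 ^ r⁻¹.toReal)) =
            eLpNorm g r volume * (H z.1 ^ (1 - q⁻¹.toReal) *
              ((∏ j, F j (z.1 - θ j • z.2) ^ (P j)⁻¹.toReal) * G z.2 ^ r⁻¹.toReal)) :=
          fun z ↦ by ring
        simp_rw [hpt]
        rw [lintegral_const_mul _ (by fun_prop), mul_comm]
        gcongr
        exact hC H G F hHm hGm hFm hH hG hF
    exact ⟨key.1, key.2.1, key.2.2.trans_eq (by ring)⟩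
  obtain ⟨C₁, hC₁⟩ := weak
  obtain ⟨C₂, hC₂⟩ := strong
  refine ⟨max C₁ C₂, fun ha hb hc f g hf hg ↦ ?_, fun ha hb f g hf hg ↦ ?_⟩
  · obtain ⟨k1, k2, k3⟩ := hC₁ ha hb hc f g hf hg
    refine ⟨k1, k2, k3.trans ?_⟩
    gcongr
    exact le_max_left _ _
  · obtain ⟨k1, k2, k3⟩ := hC₂ ha hb f g hf hg
    refine ⟨k1, k2, k3.trans ?_⟩
    gcongr
    exact le_max_right _ _
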